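/- Let $X$ be a real or complex Banach space, with unit sphere $S_X$ and dual space $X^*$. We call $X$ \emph{uniformly micro-semitransitive} if there is a function $\beta\colon(0,2)\to(0,\infty)$ such that for every $\varepsilon\in(0,2)$ and all $x,y\in S_X$ with $\|x-y\|<\beta(\varepsilon)$ there is a bounded linear operator $T\colon X\to X$ with $\|T\|=1$, $Tx=y$ and $\|T-\mathrm{Id}\|<\varepsilon$. We call $X$ \emph{micro-transitive} if its group $G$ of surjective linear isometries, with the operator norm topology, acts micro-transitively on $S_X$, that is, for every $x\in S_X$ and every neighbourhood $U$ of $\mathrm{Id}$ in $G$, the set $Ux=\{Tx : T\in U\}$ is a neighbourhood of $x$ in $S_X$. Then $X$ is uniformly micro-semitransitive if and only if $X^*$ is uniformly micro-semitransitive, and $X$ is micro-transitive if and only if $X^*$ is micro-transitive. -/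

import Mathlib

/-- A Banach space `X` is uniformly micro-semitransitive if there is a function
`β : (0,2) → (0,∞)` such that, for all `ε ∈ (0,2)` and all `x, y` in the unit sphere of `X` with
`‖x - y‖ < β ε`, there is a bounded linear operator `T` on `X` with `‖T‖ = 1`, `T x = y` and
`‖T - Id‖ < ε`. -/
def UniformlyMicroSemitransitive (𝕜 X : Type*) [RCLike 𝕜] [NormedAddCommGroup X]
    [NormedSpace 𝕜 X] : Prop :=
  ∃ β : Set.Ioo (0 : ℝ) 2 → Set.Ioi (0 : ℝ),
    ∀ (ε : Set.Ioo (0 : ℝ) 2) (x y : X), ‖x‖ = 1 → ‖y‖ = 1 → ‖x - y‖ < β ε →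
      ∃ T : X →L[𝕜] X, ‖T‖ = 1 ∧ T x = y ∧ ‖T - ContinuousLinearMap.id 𝕜 X‖ < ε

/-- A continuous action of a topological group `G` on a space `S` is micro-transitive if for every
point `x` and every neighbourhood `U` of the identity of `G`, the set `U x = {g x | g ∈ U}` is a
neighbourhood of `x`. -/
def IsMicroTransitiveAction (G S : Type*) [Group G] [TopologicalSpace G] [IsTopologicalGroup G]
    [TopologicalSpace S] [MulAction G S] [ContinuousSMul G S] : Prop :=
  ∀ x : S, ∀ U ∈ nhds (1 : G), (fun g : G => g • x) '' U ∈ nhds x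

section IsometryGroup

variable {𝕜 X : Type*} [RCLike 𝕜] [NormedAddCommGroup X] [NormedSpace 𝕜 X]

/-- A surjective linear isometry of `X`, regarded as a bounded linear operator on `X`. -/
def isometryToOperator (g : X ≃ₗᵢ[𝕜] X) : X →L[𝕜] X :=
  g.toLinearIsometry.toContinuousLinearMap

theorem isometryToOperator_apply (g : X ≃ₗᵢ[𝕜] X) (x : X) : isometryToOperator g x = g x := rfl

/-- The group of surjective linear isometries of `X` carries the topology of the operator norm. -/
instance isometryGroupTopology : TopologicalSpace (X ≃ₗᵢ[𝕜] X) :=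
  TopologicalSpace.induced isometryToOperator inferInstance

theorem continuous_isometryToOperator :
    Continuous (isometryToOperator : (X ≃ₗᵢ[𝕜] X) → X →L[𝕜] X) :=
  continuous_induced_dom

theorem norm_inv_sub_inv_le (g h : X ≃ₗᵢ[𝕜] X) :
    ‖isometryToOperator g⁻¹ - isometryToOperator h⁻¹‖
      ≤ ‖isometryToOperator g - isometryToOperator h‖ := by
  refine ContinuousLinearMap.opNorm_le_bound _ (norm_nonneg _) fun x => ?_
  have h1 : ‖g⁻¹ x - h⁻¹ x‖ = ‖(isometryToOperator g - isometryToOperator h) (h⁻¹ x)‖ := by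
    rw [← g.norm_map (g⁻¹ x - h⁻¹ x), map_sub]
    have e1 : g (g⁻¹ x) = x := g.apply_symm_apply x
    have e2 : h (h⁻¹ x) = x := h.apply_symm_apply x
    rw [sub_apply, isometryToOperator_apply, isometryToOperator_apply, e1, e2,
      norm_sub_rev]
  have h2 : ‖h⁻¹ x‖ = ‖x‖ := (h⁻¹).norm_map x
  rw [sub_apply, isometryToOperator_apply, isometryToOperator_apply, h1, ← h2]
  exact ContinuousLinearMap.le_opNorm _ _

instance isometryGroup_isTopologicalGroup : IsTopologicalGroup (X ≃ₗᵢ[𝕜] X) where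
  continuous_mul := by
    refine continuous_induced_rng.2 ?_
    have h1 : Continuous fun p : (X ≃ₗᵢ[𝕜] X) × (X ≃ₗᵢ[𝕜] X) => isometryToOperator p.1 :=
      continuous_isometryToOperator.comp continuous_fst
    have h2 : Continuous fun p : (X ≃ₗᵢ[𝕜] X) × (X ≃ₗᵢ[𝕜] X) => isometryToOperator p.2 :=
      continuous_isometryToOperator.comp continuous_snd
    exact h1.clm_comp h2
  continuous_inv := by
    refine continuous_induced_rng.2 (continuous_iff_continuousAt.2 fun h => ?_)
    refine tendsto_iff_norm_sub_tendsto_zero.2 ?_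
    exact squeeze_zero (fun _ => norm_nonneg _) (fun g => norm_inv_sub_inv_le g h)
      (tendsto_iff_norm_sub_tendsto_zero.1 (continuous_isometryToOperator.tendsto h))

/-- Surjective linear isometries act on the unit sphere by evaluation. -/
instance isometryGroupSphereAction : MulAction (X ≃ₗᵢ[𝕜] X) (Metric.sphere (0 : X) 1) where
  smul g x := ⟨g x, by
    rw [mem_sphere_zero_iff_norm, g.norm_map]
    exact mem_sphere_zero_iff_norm.1 x.2⟩
  one_smul _ := rfl
  mul_smul _ _ _ := rfl

instance isometryGroupSphere_continuousSMul :
    ContinuousSMul (X ≃ₗᵢ[𝕜] X) (Metric.sphere (0 : X) 1) where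
  continuous_smul := by
    refine Continuous.subtype_mk
      (f := fun p : (X ≃ₗᵢ[𝕜] X) × Metric.sphere (0 : X) 1 => p.1 (p.2 : X)) ?_ _
    have h1 : Continuous fun p : (X ≃ₗᵢ[𝕜] X) × Metric.sphere (0 : X) 1 =>
        isometryToOperator p.1 := continuous_isometryToOperator.comp continuous_fst
    exact h1.clm_apply (continuous_subtype_val.comp continuous_snd)

end IsometryGroup

/-- The norm of `X` is micro-transitive if the group of surjective linear isometries of `X`, with
the operator norm topology, acts micro-transitively on the unit sphere of `X`. -/
def MicroTransitive (𝕜 X : Type*) [RCLike 𝕜] [NormedAddCommGroup X] [NormedSpace 𝕜 X] : Prop :=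
  IsMicroTransitiveAction (X ≃ₗᵢ[𝕜] X) (Metric.sphere (0 : X) 1)

/-!
The proof goes through the geometry of the unit ball: a uniformly micro-semitransitive Banach space
`X` is uniformly smooth, uniformly convex and reflexive, and then adjoints of the operators on `X`
serve on the dual.

*Smoothness.* If `T` is close to the identity, `T x = y`, and `g` supports the unit ball at `y`,
then `g ∘ T` supports it at `x` and is close to `g`. This bounds `‖x + h‖ + ‖x - h‖` and gives
uniform smoothness (`UniformlyMicroSemitransitive.uniformlySmooth`).

*Reflexivity.* Uniform smoothness of a space is uniform convexity of its dual, so it passes from `X`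
to its double dual, where it forces every functional on the double dual that vanishes on `X` to be
zero (`UniformlySmooth.isReflexiveSpace`).

*Convexity.* In a reflexive space the unit ball has slices of arbitrarily small diameter, by a Baire
category argument in the dual (`IsReflexiveSpace.exists_small_slice`). Moving along a short path on
the sphere in a bounded number of steps, one sends any point of the sphere to any other one by a
contraction bounded below by a constant that does not depend on the two points
(`UniformlyMicroSemitransitive.exists_boundedBelow`). By smoothness such contractions carry any
slice into a given small one, so all slices are uniformly small
(`UniformlyMicroSemitransitive.uniformConvexSpace`).

*Duality.* Close norm-one functionals `f` and `g` attain their norms at points `x` and `y`, which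
are close by uniform convexity. If a contraction `T` close to the identity satisfies `T y = x`, then
`f ∘ T` supports the ball at `y`, so that `f ∘ T = g` by smoothness
(`UniformlyMicroSemitransitive.exists_duality`): the adjoint of `T` moves `f` to `g`. For the
converse, apply this to the dual of `X` and use that `X` is reflexive when its dual is.

Micro-transitivity is treated in the same way. The orbits of the isometry group on the sphere are
open, so the action is transitive, and conjugation makes the estimates uniform
(`microTransitive_iff`); the operators `T` are now surjective isometries, and so are their adjoints.
-/

open RCLike Metric Set NormedSpace

/-! ### Functionals and their real parts -/

section Functionals

variable {𝕜 E : Type*} [RCLike 𝕜] [NormedAddCommGroup E] [NormedSpace 𝕜 E]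

theorem StrongDual.re_apply_le (f : StrongDual 𝕜 E) (x : E) : re (f x) ≤ ‖f‖ * ‖x‖ :=
  (re_le_norm _).trans (f.le_opNorm x)

theorem StrongDual.re_apply_le_norm (f : StrongDual 𝕜 E) {x : E} (hx : ‖x‖ ≤ 1) :
    re (f x) ≤ ‖f‖ :=
  (f.re_apply_le x).trans (mul_le_of_le_one_right (norm_nonneg _) hx)

theorem StrongDual.re_apply_le_norm' {f : StrongDual 𝕜 E} (hf : ‖f‖ ≤ 1) (x : E) :
    re (f x) ≤ ‖x‖ :=
  (f.re_apply_le x).trans (mul_le_of_le_one_left (norm_nonneg _) hf)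

theorem StrongDual.norm_le_of_re_le {f : StrongDual 𝕜 E} {C : ℝ} (hC : 0 ≤ C)
    (h : ∀ x, ‖x‖ ≤ 1 → re (f x) ≤ C) : ‖f‖ ≤ C := by
  refine ContinuousLinearMap.opNorm_le_of_unit_norm hC fun x hx => ?_
  obtain ⟨c, hc, hcx⟩ := exists_norm_eq_mul_self (f x)
  have := h (c • x) (by rw [norm_smul, hc, hx, one_mul])
  rwa [map_smul, smul_eq_mul, ← hcx, ofReal_re] at this

theorem StrongDual.exists_lt_re {f : StrongDual 𝕜 E} {r : ℝ} (h : r < ‖f‖) :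
    ∃ x, ‖x‖ ≤ 1 ∧ r < re (f x) := by
  rcases lt_or_ge r 0 with hr | hr
  · exact ⟨0, by simp, by simpa using hr⟩
  · by_contra! H
    exact absurd (StrongDual.norm_le_of_re_le hr H) (not_le.2 h)

/-- A point of norm `1` has a supporting functional. -/
theorem exists_support (𝕜 : Type*) [RCLike 𝕜] [NormedSpace 𝕜 E] {x : E} (hx : ‖x‖ = 1) :
    ∃ f : StrongDual 𝕜 E, ‖f‖ = 1 ∧ f x = 1 := by
  obtain ⟨f, hf, h⟩ := exists_dual_vector 𝕜 x (by simp [hx])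
  exact ⟨f, hf, by simp [h, hx]⟩

end Functionals

/-! ### Uniform smoothness and its duality with uniform convexity -/

/-- A normed space is uniformly smooth if `(‖x + h‖ + ‖x - h‖ - 2) / ‖h‖` tends to `0` as `h`
tends to `0`, uniformly for `x` in the unit sphere. -/
def UniformlySmooth (E : Type*) [NormedAddCommGroup E] : Prop :=
  ∀ ε > 0, ∃ δ > 0, ∀ x h : E, ‖x‖ = 1 → ‖h‖ ≤ δ → ‖x + h‖ + ‖x - h‖ ≤ 2 + ε * ‖h‖

section Smooth

variable {𝕜 E : Type*} [RCLike 𝕜] [NormedAddCommGroup E] [NormedSpace 𝕜 E]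

/-- In a uniformly smooth space, the slices of the dual ball determined by points of the unit
sphere have uniformly small diameter. -/
theorem UniformlySmooth.slice (hE : UniformlySmooth E) {ε : ℝ} (hε : 0 < ε) :
    ∃ δ > 0, ∀ (x : E) (f g : StrongDual 𝕜 E), ‖x‖ = 1 → ‖f‖ ≤ 1 → ‖g‖ ≤ 1 →
      1 - δ ≤ re (f x) → 1 - δ ≤ re (g x) → ‖f - g‖ ≤ ε := by
  obtain ⟨t, ht, H⟩ := hE (ε / 2) (by positivity)
  refine ⟨ε * t / 4, by positivity, fun x f g hx hf hg hfx hgx => ?_⟩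
  refine StrongDual.norm_le_of_re_le hε.le fun h hh => ?_
  have hn : ‖(t : 𝕜) • h‖ ≤ t := by
    rw [norm_smul, norm_ofReal, abs_of_pos ht]
    exact mul_le_of_le_one_right ht.le hh
  have h1 := H x ((t : 𝕜) • h) hx hn
  have h2 := StrongDual.re_apply_le_norm' hf (x + (t : 𝕜) • h)
  have h3 := StrongDual.re_apply_le_norm' hg (x - (t : 𝕜) • h)
  simp only [map_add, map_sub, map_smul, smul_eq_mul, re_ofReal_mul] at h2 h3
  rw [sub_apply, map_sub]
  have h4 : ε / 2 * ‖(t : 𝕜) • h‖ ≤ ε / 2 * t := by gcongr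
  have h5 : t * (re (f h) - re (g h)) ≤ t * ε := by nlinarith
  exact le_of_mul_le_mul_left h5 ht

theorem UniformlySmooth.support_unique (hE : UniformlySmooth E) {x : E} {f g : StrongDual 𝕜 E}
    (hx : ‖x‖ = 1) (hf : ‖f‖ ≤ 1) (hg : ‖g‖ ≤ 1) (hfx : f x = 1) (hgx : g x = 1) : f = g := by
  rw [← sub_eq_zero, ← norm_le_zero_iff]
  refine le_of_forall_pos_le_add fun ε hε => ?_
  obtain ⟨δ, hδ, H⟩ := hE.slice (𝕜 := 𝕜) hε
  have := H x f g hx hf hg (by simp [hfx, hδ.le]) (by simp [hgx, hδ.le])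
  linarith

theorem UniformlySmooth.uniformConvexSpace_dual (hE : UniformlySmooth E) :
    UniformConvexSpace (StrongDual 𝕜 E) := by
  refine ⟨fun ε hε => ?_⟩
  obtain ⟨δ, hδ, H⟩ := hE.slice (𝕜 := 𝕜) (half_pos hε)
  refine ⟨min δ 1, by positivity, fun f hf g hg hfg => ?_⟩
  by_contra! hlt
  obtain ⟨x, hx, hx'⟩ := StrongDual.exists_lt_re hlt
  rw [add_apply, map_add] at hx'
  have hm : min δ 1 ≤ δ := min_le_left _ _
  have hm1 : min δ 1 ≤ 1 := min_le_right _ _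
  have hfx := f.re_apply_le x
  have hgx := g.re_apply_le x
  rw [hf, one_mul] at hfx
  rw [hg, one_mul] at hgx
  have hx0 : 0 < ‖x‖ := by linarith
  -- normalize `x`, which only increases the values of `f` and `g` since these are nonnegative
  have key : ∀ k : StrongDual 𝕜 E, 1 - δ ≤ re (k x) → 0 ≤ re (k x) →
      1 - δ ≤ re (k (((‖x‖⁻¹ : ℝ) : 𝕜) • x)) := by
    intro k h1 h2
    rw [map_smul, smul_eq_mul, re_ofReal_mul]
    exact h1.trans (le_mul_of_one_le_left h2 ((one_le_inv₀ hx0).2 hx))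
  have := H (((‖x‖⁻¹ : ℝ) : 𝕜) • x) f g
    (by rw [norm_smul, norm_ofReal, abs_of_pos (by positivity), inv_mul_cancel₀ hx0.ne'])
    hf.le hg.le (key f (by linarith) (by linarith)) (key g (by linarith) (by linarith))
  linarith

/-- Uniform convexity on the closed unit ball, for a space over `ℝ` or `ℂ`. -/
theorem UniformConvexSpace.exists_norm_sub_le (𝕜 : Type*) [RCLike 𝕜] [NormedSpace 𝕜 E]
    [UniformConvexSpace E] {ε : ℝ} (hε : 0 < ε) :
    ∃ δ > 0, ∀ x y : E, ‖x‖ ≤ 1 → ‖y‖ ≤ 1 → 2 - δ ≤ ‖x + y‖ → ‖x - y‖ ≤ ε := by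
  let : NormedSpace ℝ E := .restrictScalars ℝ 𝕜 E
  obtain ⟨δ, hδ, H⟩ := exists_forall_closed_ball_dist_add_le_two_sub E hε
  refine ⟨δ / 2, by positivity, fun x y hx hy hxy => ?_⟩
  by_contra! h
  have := H hx hy h.le
  linarith

theorem UniformConvexSpace.uniformlySmooth_dual [UniformConvexSpace E] :
    UniformlySmooth (StrongDual 𝕜 E) := by
  intro ε hε
  obtain ⟨δ, hδ, H⟩ := UniformConvexSpace.exists_norm_sub_le (E := E) 𝕜 (half_pos hε)
  refine ⟨δ / (4 + ε), by positivity, fun f h hf hh => ?_⟩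
  rcases (norm_nonneg h).eq_or_lt with h0 | h0
  · rw [norm_eq_zero.1 h0.symm]; simp [hf]; norm_num
  -- points `x`, `y` at which `f + h` and `f - h` attain their norms up to `ε ‖h‖ / 4`
  obtain ⟨x, hx, hx'⟩ := StrongDual.exists_lt_re (f := f + h)
    (sub_lt_self _ (by positivity : 0 < ε * ‖h‖ / 4))
  obtain ⟨y, hy, hy'⟩ := StrongDual.exists_lt_re (f := f - h)
    (sub_lt_self _ (by positivity : 0 < ε * ‖h‖ / 4))
  have hsum : re (f (x + y)) ≤ ‖x + y‖ := StrongDual.re_apply_le_norm' hf.le _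
  have hdiff : re (h (x - y)) ≤ ‖h‖ * ‖x - y‖ := h.re_apply_le _
  have hp : ‖f‖ - ‖h‖ ≤ ‖f + h‖ := by
    have := norm_sub_le (f + h) h; rw [add_sub_cancel_right] at this; linarith
  have hm : ‖f‖ - ‖h‖ ≤ ‖f - h‖ := by
    have := norm_add_le (f - h) h; rw [sub_add_cancel] at this; linarith
  have hhx := h.re_apply_le_norm hx
  have hhy := (-h).re_apply_le_norm hy
  rw [norm_neg] at hhy
  simp only [add_apply, sub_apply, neg_apply, map_add, map_sub, map_neg] at *
  rw [le_div_iff₀ (by positivity)] at hh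
  have hεh : 0 < ε * ‖h‖ := by positivity
  have hxy := H x y hx hy (by linarith)
  have : ‖h‖ * ‖x - y‖ ≤ ‖h‖ * (ε / 2) := by gcongr
  have hxy1 : re (f x) ≤ 1 := by have := f.re_apply_le_norm hx; rwa [hf] at this
  have hxy2 : re (f y) ≤ 1 := by have := f.re_apply_le_norm hy; rwa [hf] at this
  linarith

end Smooth

/-! ### Reflexivity -/

/-- A normed space is reflexive if the canonical map into its double dual is surjective. -/
def IsReflexiveSpace (𝕜 E : Type*) [RCLike 𝕜] [NormedAddCommGroup E] [NormedSpace 𝕜 E] : Prop :=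
  Function.Surjective (inclusionInDoubleDual 𝕜 E)

section Reflexive

variable {𝕜 E : Type*} [RCLike 𝕜] [NormedAddCommGroup E] [NormedSpace 𝕜 E]

theorem norm_inclusionInDoubleDual (x : E) : ‖inclusionInDoubleDual 𝕜 E x‖ = ‖x‖ :=
  (inclusionInDoubleDualLi 𝕜 (E := E)).norm_map x

/-- Hahn–Banach separation of a point from a closed subspace. -/
theorem exists_dual_vanishing {W : Submodule 𝕜 E} (hW : IsClosed (W : Set E)) {x : E}
    (hx : x ∉ W) : ∃ f : StrongDual 𝕜 E, ‖f‖ = 1 ∧ f x ≠ 0 ∧ ∀ w ∈ W, f w = 0 := by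
  have : IsClosed (W : Set E) := hW
  have hne : W.mkQL x ≠ 0 := by
    simpa [Submodule.Quotient.mk_eq_zero] using hx
  obtain ⟨g, -, hgx⟩ := exists_dual_vector 𝕜 (W.mkQL x) (norm_ne_zero_iff.2 hne)
  have h1 : (g ∘L W.mkQL) x ≠ 0 := by
    rw [ContinuousLinearMap.comp_apply, hgx]
    exact_mod_cast norm_ne_zero_iff.2 hne
  have h2 : g ∘L W.mkQL ≠ 0 := fun h => h1 (by rw [h]; rfl)
  have h3 : ‖g ∘L W.mkQL‖ ≠ 0 := norm_ne_zero_iff.2 h2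
  refine ⟨((‖g ∘L W.mkQL‖⁻¹ : ℝ) : 𝕜) • (g ∘L W.mkQL), ?_, ?_, fun w hw => ?_⟩
  · rw [norm_smul, norm_ofReal, abs_inv, abs_norm, inv_mul_cancel₀ h3]
  · rw [smul_apply, smul_eq_mul]
    exact mul_ne_zero (by exact_mod_cast inv_ne_zero h3) h1
  · have : W.mkQL w = 0 := by simpa [Submodule.Quotient.mk_eq_zero] using hw
    rw [smul_apply, ContinuousLinearMap.comp_apply, this, map_zero, smul_zero]

theorem exists_dual_vanishing_of_isometry {F : Type*} [NormedAddCommGroup F] [NormedSpace 𝕜 F]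
    [CompleteSpace E] {L : E →L[𝕜] F} (hL : Isometry L) (h : ¬ Function.Surjective L) :
    ∃ f : StrongDual 𝕜 F, ‖f‖ = 1 ∧ ∀ x, f (L x) = 0 := by
  obtain ⟨y, hy⟩ := not_forall.1 h
  have hc : IsClosed (LinearMap.range L.toLinearMap : Set F) := by
    rw [LinearMap.coe_range]
    exact hL.isClosedEmbedding.isClosed_range
  obtain ⟨f, hf, -, hf0⟩ := exists_dual_vanishing hc (x := y)
    fun hm => hy (LinearMap.mem_range.1 hm)
  exact ⟨f, hf, fun x => hf0 _ ⟨x, rfl⟩⟩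

/-- Let `L` embed a Banach space `E` isometrically into the dual of `Y` so that the unit ball of
`E` norms `Y`. If the dual of `Y` is uniformly smooth, then `L` is surjective: otherwise some
functional of norm `1` vanishes on the range of `L`; almost norming functionals being almost unique,
it is close to evaluation at some `f` in the unit ball of `Y` of norm more than `1 / 2`, although
this evaluation is not small on the image under `L` of the unit ball. -/
theorem surjective_of_uniformlySmooth_dual {Y : Type*} [NormedAddCommGroup Y] [NormedSpace 𝕜 Y]
    [CompleteSpace E] (hS : UniformlySmooth (StrongDual 𝕜 Y)) {L : E →L[𝕜] StrongDual 𝕜 Y}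
    (hL : Isometry L) (hnorm : ∀ f : Y, ∀ r < ‖f‖, ∃ x, ‖x‖ ≤ 1 ∧ r < re (L x f)) :
    Function.Surjective L := by
  by_contra hn
  obtain ⟨Φ, hΦ, hΦ0⟩ := exists_dual_vanishing_of_isometry hL hn
  obtain ⟨δ, hδ, H⟩ := hS.slice (𝕜 := 𝕜) (by norm_num : (0 : ℝ) < 1 / 4)
  obtain ⟨F, hF, hΦF⟩ : ∃ F, ‖F‖ = 1 ∧ 1 - δ ≤ re (Φ F) := by
    obtain ⟨G, hG, hΦG⟩ := StrongDual.exists_lt_re (f := Φ) (r := max (1 - δ) (1 / 2))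
      (by rw [hΦ]; exact max_lt (by linarith) (by norm_num))
    have hr := Φ.re_apply_le G
    rw [hΦ, one_mul] at hr
    have h1 := le_max_left (1 - δ) (1 / 2)
    have h2 := le_max_right (1 - δ) (1 / 2)
    have hG0 : 0 < ‖G‖ := by linarith
    refine ⟨((‖G‖⁻¹ : ℝ) : 𝕜) • G, ?_, ?_⟩
    · rw [norm_smul, norm_ofReal, abs_inv, abs_norm, inv_mul_cancel₀ hG0.ne']
    · rw [map_smul, smul_eq_mul, re_ofReal_mul]
      exact (h1.trans hΦG.le).trans
        (le_mul_of_one_le_left (by linarith) ((one_le_inv₀ hG0).2 hG))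
  obtain ⟨f, hf, hFf⟩ := StrongDual.exists_lt_re (f := F) (r := max (1 - δ) (1 / 2))
    (by rw [hF]; exact max_lt (by linarith) (by norm_num))
  have hclose := H F Φ (inclusionInDoubleDual 𝕜 Y f) hF hΦ.le
    ((norm_inclusionInDoubleDual f).trans_le hf) hΦF
    (by rw [dual_def]; exact (le_max_left _ _).trans hFf.le)
  have hf2 : 1 / 2 < ‖f‖ := by
    have h1 := F.re_apply_le f
    rw [hF, one_mul] at h1
    exact ((le_max_right _ _).trans_lt hFf).trans_le h1
  obtain ⟨x, hx, hfx⟩ := hnorm f _ hf2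
  have h1 := (inclusionInDoubleDual 𝕜 Y f - Φ).re_apply_le_norm
    (x := L x) ((hL.norm_map_of_map_zero (map_zero L) x).trans_le hx)
  rw [norm_sub_rev, sub_apply, dual_def, hΦ0 x, sub_zero] at h1
  linarith

theorem isometry_inclusionInDoubleDual : Isometry (inclusionInDoubleDual 𝕜 E) :=
  (inclusionInDoubleDualLi 𝕜 (E := E)).isometry

/-- A uniformly smooth Banach space is reflexive, since its double dual is uniformly smooth too. -/
theorem UniformlySmooth.isReflexiveSpace [CompleteSpace E] (hE : UniformlySmooth E) :
    IsReflexiveSpace 𝕜 E := by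
  have : UniformConvexSpace (StrongDual 𝕜 E) := hE.uniformConvexSpace_dual
  have hS : UniformlySmooth (StrongDual 𝕜 (StrongDual 𝕜 E)) :=
    UniformConvexSpace.uniformlySmooth_dual
  exact surjective_of_uniformlySmooth_dual hS isometry_inclusionInDoubleDual
    fun f r hr => StrongDual.exists_lt_re hr

theorem surjective_of_isReflexiveSpace {Y : Type*} [NormedAddCommGroup Y] [NormedSpace 𝕜 Y]
    [CompleteSpace E] (hY : IsReflexiveSpace 𝕜 Y) {L : E →L[𝕜] StrongDual 𝕜 Y}
    (hL : Isometry L) (hsep : ∀ f : Y, (∀ x, L x f = 0) → f = 0) : Function.Surjective L := by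
  by_contra hn
  obtain ⟨Φ, hΦ, hΦ0⟩ := exists_dual_vanishing_of_isometry hL hn
  obtain ⟨f, rfl⟩ := hY Φ
  rw [norm_inclusionInDoubleDual, hsep f hΦ0, norm_zero] at hΦ
  exact zero_ne_one hΦ

/-- A Banach space with reflexive dual is reflexive. -/
theorem IsReflexiveSpace.of_dual [CompleteSpace E] (h : IsReflexiveSpace 𝕜 (StrongDual 𝕜 E)) :
    IsReflexiveSpace 𝕜 E :=
  surjective_of_isReflexiveSpace h isometry_inclusionInDoubleDual
    fun _ hf => ContinuousLinearMap.ext hf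

/-- In a reflexive space, the restriction of a functional to a closed subspace attains its norm. -/
theorem IsReflexiveSpace.exists_mem_apply_eq (hE : IsReflexiveSpace 𝕜 E) {W : Submodule 𝕜 E}
    (hW : IsClosed (W : Set E)) (f : StrongDual 𝕜 E) :
    ∃ x ∈ W, ‖x‖ ≤ 1 ∧ f x = ‖f ∘L W.subtypeL‖ := by
  obtain ⟨F, hF, hFf⟩ := exists_dual_vector'' 𝕜 (f ∘L W.subtypeL)
  obtain ⟨x, hx⟩ := hE (F ∘L (ContinuousLinearMap.compL 𝕜 W E 𝕜).flip W.subtypeL)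
  have hval : ∀ g : StrongDual 𝕜 E, g x = F (g ∘L W.subtypeL) := fun g => by
    rw [← dual_def 𝕜 E x g, hx]; rfl
  refine ⟨x, ?_, ?_, by rw [hval, hFf]⟩
  · by_contra hxW
    obtain ⟨g, -, hgx, hg⟩ := exists_dual_vanishing hW hxW
    refine hgx ?_
    have : g ∘L W.subtypeL = 0 := by ext w; exact hg w w.2
    rw [hval, this, map_zero]
  · refine norm_le_dual_bound 𝕜 x zero_le_one fun g => ?_
    rw [hval]
    calc ‖F (g ∘L W.subtypeL)‖ ≤ ‖F‖ * ‖g ∘L W.subtypeL‖ := F.le_opNorm _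
      _ ≤ 1 * (‖g‖ * 1) := by
        gcongr
        refine (ContinuousLinearMap.opNorm_comp_le _ _).trans ?_
        gcongr
        exact W.norm_subtypeL_le
      _ = 1 * ‖g‖ := by ring

theorem IsReflexiveSpace.exists_apply_eq_one (hE : IsReflexiveSpace 𝕜 E) {f : StrongDual 𝕜 E}
    (hf : ‖f‖ = 1) : ∃ x, ‖x‖ = 1 ∧ f x = 1 := by
  obtain ⟨F, hF, hFf⟩ := exists_support 𝕜 hf
  obtain ⟨x, rfl⟩ := hE F
  exact ⟨x, by rwa [norm_inclusionInDoubleDual] at hF, hFf⟩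

/-- The canonical isometry of a reflexive space onto its double dual. -/
noncomputable def IsReflexiveSpace.equivDoubleDual (hE : IsReflexiveSpace 𝕜 E) :
    E ≃ₗᵢ[𝕜] StrongDual 𝕜 (StrongDual 𝕜 E) :=
  LinearIsometryEquiv.ofSurjective (inclusionInDoubleDualLi 𝕜) hE

end Reflexive

/-! ### Small slices of the unit ball of a reflexive space -/

section Slices

variable {𝕜 E : Type*} [RCLike 𝕜] [NormedAddCommGroup E] [NormedSpace 𝕜 E]

/-- Every slice of the closed unit ball of `E`, that is, every set of points of the unit ball at
which a given functional is almost equal to its norm, contains two points at distance more than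
`ε`. -/
def HasLargeSlices (𝕜 E : Type*) [RCLike 𝕜] [NormedAddCommGroup E] [NormedSpace 𝕜 E]
    (ε : ℝ) : Prop :=
  ∀ (f : StrongDual 𝕜 E), ∀ α > 0, ∃ u v : E, ‖u‖ ≤ 1 ∧ ‖v‖ ≤ 1 ∧
    ‖f‖ - α ≤ re (f u) ∧ ‖f‖ - α ≤ re (f v) ∧ ε < ‖u - v‖

theorem hasLargeSlices_of_norm_one [Nontrivial E] {ε : ℝ}
    (h : ∀ f : StrongDual 𝕜 E, ‖f‖ = 1 → ∀ α > 0, ∃ u v : E, ‖u‖ ≤ 1 ∧ ‖v‖ ≤ 1 ∧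
      1 - α ≤ re (f u) ∧ 1 - α ≤ re (f v) ∧ ε < ‖u - v‖) : HasLargeSlices 𝕜 E ε := by
  intro f α hα
  rcases (norm_nonneg f).eq_or_lt with h0 | h0
  · obtain ⟨g, hg, -⟩ := exists_dual_vector' 𝕜 (0 : E)
    obtain ⟨u, v, hu, hv, -, -, huv⟩ := h g hg 1 one_pos
    have hf : f = 0 := norm_eq_zero.1 h0.symm
    exact ⟨u, v, hu, hv, by simp [hf, hα.le], by simp [hf, hα.le], huv⟩
  · obtain ⟨u, v, hu, hv, h1, h2, huv⟩ := h (((‖f‖⁻¹ : ℝ) : 𝕜) • f)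
      (by rw [norm_smul, norm_ofReal, abs_inv, abs_norm, inv_mul_cancel₀ h0.ne'])
      (‖f‖⁻¹ * α) (by positivity)
    rw [smul_apply, smul_eq_mul, re_ofReal_mul, ← inv_mul_cancel₀ h0.ne', ← mul_sub] at h1 h2
    exact ⟨u, v, hu, hv, le_of_mul_le_mul_left h1 (by positivity),
      le_of_mul_le_mul_left h2 (by positivity), huv⟩

/-- If all slices are large, then the functionals attaining their norm at some point close to a
given `p` are nowhere dense: a functional almost attains its norm at a point `u` far from `p`, and
adding a small multiple of a functional norming `u - p` makes `u` preferable to all points close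
to `p`. -/
theorem HasLargeSlices.exists_closedBall {ε : ℝ} (hε : 0 < ε) (h : HasLargeSlices 𝕜 E ε)
    (f : StrongDual 𝕜 E) {r : ℝ} (hr : 0 < r) (p : E) :
    ∃ f' : StrongDual 𝕜 E, ∃ r' > 0, closedBall f' r' ⊆ closedBall f r ∧
      ∀ g ∈ closedBall f' r', ∀ x, ‖x‖ ≤ 1 → re (g x) = ‖g‖ → ε / 8 < ‖x - p‖ := by
  set t := r / 2 with ht
  have ht0 : 0 < t := by positivity
  obtain ⟨u, hu, hfu, hup⟩ : ∃ u, ‖u‖ ≤ 1 ∧ ‖f‖ - t * ε / 8 ≤ re (f u) ∧ ε / 2 < ‖u - p‖ := by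
    obtain ⟨u, v, hu, hv, h1, h2, huv⟩ := h f (t * ε / 8) (by positivity)
    by_contra! H
    have h3 := H u hu h1
    have h4 := H v hv h2
    have h5 := norm_sub_le_norm_sub_add_norm_sub u p v
    rw [norm_sub_rev p v] at h5
    linarith
  obtain ⟨w, hw, hwu⟩ := exists_dual_vector'' 𝕜 (u - p)
  have hwre : re (w u) - re (w p) = ‖u - p‖ := by
    rw [← map_sub, ← map_sub, hwu, ofReal_re]
  -- `u` is then preferable to the points of norm at most `1` within `ε / 8` of `p` by
  -- `t * (ε / 2 - ε / 8) - t * ε / 8 = t * ε / 4`, of which variations of size `r'` lose `2 * r'`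
  set r' := min (t * ε / 16) (r / 2) with hr'
  have hr1 : r' ≤ t * ε / 16 := min_le_left _ _
  have hr2 : r' ≤ r / 2 := min_le_right _ _
  refine ⟨f + (t : 𝕜) • w, r', by positivity, ?_, fun g hg x hx hgx => ?_⟩
  · refine closedBall_subset_closedBall' ?_
    rw [dist_eq_norm, add_sub_cancel_left, norm_smul, norm_ofReal, abs_of_pos ht0]
    have : t * ‖w‖ ≤ t := mul_le_of_le_one_right ht0.le hw
    linarith
  · by_contra! hxp
    rw [mem_closedBall, dist_eq_norm] at hg
    have hu' := (f + (t : 𝕜) • w - g).re_apply_le_norm hu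
    have hx' := (g - (f + (t : 𝕜) • w)).re_apply_le_norm hx
    rw [norm_sub_rev] at hu'
    simp only [sub_apply, add_apply, smul_apply, smul_eq_mul, map_add, map_sub,
      re_ofReal_mul] at hu' hx'
    have hwx : re (w (x - p)) ≤ ‖x - p‖ := StrongDual.re_apply_le_norm' hw _
    simp only [map_sub] at hwx
    have hgu := g.re_apply_le_norm hu
    have hfx := f.re_apply_le_norm hx
    have key : t * (ε / 2 - ε / 8) < t * (re (w u) - re (w x)) :=
      mul_lt_mul_of_pos_left (by linarith) ht0
    linarith [mul_pos ht0 hε]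

theorem HasLargeSlices.exists_closedBall_finite {ε : ℝ} (hε : 0 < ε) (h : HasLargeSlices 𝕜 E ε)
    {s : Set E} (hs : s.Finite) (f : StrongDual 𝕜 E) {r : ℝ} (hr : 0 < r) :
    ∃ f' : StrongDual 𝕜 E, ∃ r' > 0, closedBall f' r' ⊆ closedBall f r ∧
      ∀ g ∈ closedBall f' r', ∀ x, ‖x‖ ≤ 1 → re (g x) = ‖g‖ → ∀ p ∈ s, ε / 8 < ‖x - p‖ := by
  induction s, hs using Set.Finite.induction_on with
  | empty => exact ⟨f, r, hr, subset_rfl, by simp⟩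
  | @insert a s _ _ ih =>
    obtain ⟨f₁, r₁, hr₁, hsub₁, H₁⟩ := ih
    obtain ⟨f₂, r₂, hr₂, hsub₂, H₂⟩ := h.exists_closedBall hε f₁ hr₁ a
    refine ⟨f₂, r₂, hr₂, hsub₂.trans hsub₁, fun g hg x hx hgx p hp => ?_⟩
    rcases hp with rfl | hp
    · exact H₂ g hg x hx hgx
    · exact H₁ g (hsub₂ hg) x hx hgx p hp

theorem HasLargeSlices.exists_closedBall_compact {ε : ℝ} (hε : 0 < ε) (h : HasLargeSlices 𝕜 E ε)
    {K : Set E} (hK : IsCompact K) (f : StrongDual 𝕜 E) {r : ℝ} (hr : 0 < r) :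
    ∃ f' : StrongDual 𝕜 E, ∃ r' > 0, closedBall f' r' ⊆ closedBall f r ∧
      ∀ g ∈ closedBall f' r', ∀ x, ‖x‖ ≤ 1 → re (g x) = ‖g‖ → ∀ p ∈ K, ε / 16 < ‖x - p‖ := by
  obtain ⟨t, -, ht, hcov⟩ := hK.finite_cover_balls (e := ε / 16) (by positivity)
  obtain ⟨f', r', hr', hsub, H⟩ := h.exists_closedBall_finite hε ht f hr
  refine ⟨f', r', hr', hsub, fun g hg x hx hgx p hp => ?_⟩
  obtain ⟨q, hq, hpq⟩ := mem_iUnion₂.1 (hcov hp)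
  rw [mem_ball, dist_eq_norm] at hpq
  have h1 := H g hg x hx hgx q hq
  have h2 := norm_sub_le_norm_sub_add_norm_sub x p q
  linarith

/-- The closed unit ball of a nontrivial reflexive space has slices of arbitrarily small diameter.
If not, one builds functionals `f n` converging to some `g` and finite-dimensional subspaces `V n`
such that the union of the `V n` norms `g`, while every point at which `g` attains its norm is at
distance at least `ε / 16` from all `V n`. By reflexivity `g` attains its norm in the closure of the
union of the `V n`, which is absurd. -/
theorem IsReflexiveSpace.exists_small_slice [Nontrivial E] (hE : IsReflexiveSpace 𝕜 E) {ε : ℝ}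
    (hε : 0 < ε) : ∃ f : StrongDual 𝕜 E, ‖f‖ = 1 ∧ ∃ α > 0, ∀ u v : E, ‖u‖ ≤ 1 → ‖v‖ ≤ 1 →
      1 - α ≤ re (f u) → 1 - α ≤ re (f v) → ‖u - v‖ ≤ ε := by
  by_contra! hcon
  have h : HasLargeSlices 𝕜 E ε := hasLargeSlices_of_norm_one fun f hf α hα => hcon f hf α hα
  let S := {s : StrongDual 𝕜 E × ℝ × Submodule 𝕜 E // 0 < s.2.1 ∧ FiniteDimensional 𝕜 s.2.2}
  have step : ∀ s : S, ∃ s' : S,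
      closedBall s'.1.1 s'.1.2.1 ⊆ closedBall s.1.1 s.1.2.1 ∧ s'.1.2.1 ≤ s.1.2.1 / 2 ∧
      s.1.2.2 ≤ s'.1.2.2 ∧
      (∃ y ∈ s'.1.2.2, ‖y‖ ≤ 1 ∧ ‖s.1.1‖ - s.1.2.1 ≤ re (s.1.1 y)) ∧
      ∀ g ∈ closedBall s'.1.1 s'.1.2.1, ∀ x, ‖x‖ ≤ 1 → re (g x) = ‖g‖ →
        ∀ p ∈ s'.1.2.2, ‖p‖ ≤ 2 → ε / 16 < ‖x - p‖ := by
    rintro ⟨⟨f, r, V⟩, hr, hV⟩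
    dsimp only at hr hV
    obtain ⟨y, hy, hfy⟩ := StrongDual.exists_lt_re (f := f) (sub_lt_self ‖f‖ hr)
    let V' : Submodule 𝕜 E := V ⊔ Submodule.span 𝕜 {y}
    have hV' : FiniteDimensional 𝕜 V' := inferInstance
    have hK : IsCompact ((V' : Set E) ∩ closedBall 0 2) := by
      have : ProperSpace V' := FiniteDimensional.proper 𝕜 V'
      have h1 : (Subtype.val : V' → E) '' closedBall 0 2 = (V' : Set E) ∩ closedBall 0 2 := by
        ext z
        simp only [mem_image, mem_closedBall_zero_iff, mem_inter_iff, SetLike.mem_coe]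
        constructor
        · rintro ⟨z, hz, rfl⟩; exact ⟨z.2, hz⟩
        · rintro ⟨hz, hz2⟩; exact ⟨⟨z, hz⟩, hz2, rfl⟩
      rw [← h1]
      exact (isCompact_closedBall _ _).image continuous_subtype_val
    obtain ⟨f', r', hr', hsub, H⟩ := h.exists_closedBall_compact hε hK f hr
    refine ⟨⟨⟨f', min r' (r / 2), V'⟩, lt_min hr' (half_pos hr), hV'⟩, ?_, min_le_right _ _,
      le_sup_left, ⟨y, ?_, hy, hfy.le⟩, fun g hg x hx hgx p hp hp2 => ?_⟩
    · exact (closedBall_subset_closedBall (min_le_left _ _)).trans hsub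
    · exact (le_sup_right : _ ≤ V') (Submodule.mem_span_singleton_self y)
    · exact H g (closedBall_subset_closedBall (min_le_left _ _) hg) x hx hgx p
        ⟨hp, mem_closedBall_zero_iff.2 hp2⟩
  choose F hF using step
  let s₀ : S := ⟨⟨0, 1, ⊥⟩, one_pos, inferInstance⟩
  let s : ℕ → S := fun n => F^[n] s₀
  have hs : ∀ n, s (n + 1) = F (s n) := fun n => Function.iterate_succ_apply' F n s₀
  let f : ℕ → StrongDual 𝕜 E := fun n => (s n).1.1
  let r : ℕ → ℝ := fun n => (s n).1.2.1
  let V : ℕ → Submodule 𝕜 E := fun n => (s n).1.2.2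
  have hr0 : ∀ n, 0 < r n := fun n => (s n).2.1
  have hball : Antitone fun n => closedBall (f n) (r n) := by
    refine antitone_nat_of_succ_le fun n => ?_
    have := (hF (s n)).1
    rwa [← hs n] at this
  have hrhalf : ∀ n, r (n + 1) ≤ r n / 2 := fun n => by
    have := (hF (s n)).2.1
    rwa [← hs n] at this
  have hVmono : Monotone V := by
    refine monotone_nat_of_le_succ fun n => ?_
    have := (hF (s n)).2.2.1
    rwa [← hs n] at this
  have hy : ∀ n, ∃ y ∈ V (n + 1), ‖y‖ ≤ 1 ∧ ‖f n‖ - r n ≤ re (f n y) := fun n => by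
    have := (hF (s n)).2.2.2.1
    rwa [← hs n] at this
  have hfar : ∀ n, ∀ g ∈ closedBall (f (n + 1)) (r (n + 1)), ∀ x, ‖x‖ ≤ 1 → re (g x) = ‖g‖ →
      ∀ p ∈ V (n + 1), ‖p‖ ≤ 2 → ε / 16 < ‖x - p‖ := fun n => by
    have := (hF (s n)).2.2.2.2
    rwa [← hs n] at this
  have hrle : ∀ n, r n ≤ (1 / 2) ^ n := by
    intro n
    induction n with
    | zero => simp [r, s, s₀]
    | succ n ih => rw [pow_succ]; linarith [hrhalf n]
  have hrlim : Filter.Tendsto r Filter.atTop (nhds 0) :=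
    squeeze_zero (fun n => (hr0 n).le) hrle
      (tendsto_pow_atTop_nhds_zero_of_lt_one (by norm_num) (by norm_num))
  obtain ⟨g, hg⟩ : (⋂ n, closedBall (f n) (r n)).Nonempty := by
    refine Metric.nonempty_iInter_of_nonempty_biInter (fun n => isClosed_closedBall)
      (fun n => isBounded_closedBall) (fun N => ⟨f N, mem_iInter₂.2 fun n hn => ?_⟩) ?_
    · exact hball hn (mem_closedBall_self (hr0 N).le)
    · refine squeeze_zero (fun n => diam_nonneg) (fun n => diam_closedBall (hr0 n).le) ?_
      simpa using hrlim.const_mul 2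
  rw [mem_iInter] at hg
  let W := (⨆ n, V n).topologicalClosure
  obtain ⟨x, hxW, hx, hgx⟩ := hE.exists_mem_apply_eq
    (Submodule.isClosed_topologicalClosure (⨆ n, V n)) g
  have hVW : ∀ n, V n ≤ W := fun n =>
    (le_iSup V n).trans (Submodule.le_topologicalClosure _)
  have hnorm : ‖g ∘L W.subtypeL‖ = ‖g‖ := by
    refine le_antisymm ?_ ?_
    · refine (ContinuousLinearMap.opNorm_comp_le _ _).trans ?_
      exact mul_le_of_le_one_right (norm_nonneg _) W.norm_subtypeL_le
    · have hle : ∀ n, ‖g‖ - 3 * r n ≤ ‖g ∘L W.subtypeL‖ := by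
        intro n
        obtain ⟨y, hyV, hy1, hfy⟩ := hy n
        have h1 : re (g y) ≤ ‖g ∘L W.subtypeL‖ :=
          StrongDual.re_apply_le_norm (g ∘L W.subtypeL) (x := ⟨y, hVW _ hyV⟩) hy1
        have h2 := (f n - g).re_apply_le_norm hy1
        have h3 := hg n
        rw [mem_closedBall, dist_eq_norm] at h3
        rw [norm_sub_rev, sub_apply, map_sub] at h2
        have h4 := norm_le_norm_add_norm_sub' g (f n)
        linarith
      refine le_of_tendsto' (x := Filter.atTop) ?_ hle
      simpa using (hrlim.const_mul 3).const_sub ‖g‖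
  have hgx' : re (g x) = ‖g‖ := by rw [hgx, ofReal_re, ← hnorm]
  obtain ⟨p, hp, hxp⟩ := Metric.mem_closure_iff.1 hxW (min (ε / 16) 1) (by positivity)
  rw [dist_eq_norm] at hxp
  obtain ⟨n, hpn⟩ := (Submodule.mem_iSup_of_directed V hVmono.directed_le).1 hp
  have h1 := hxp.trans_le (min_le_left _ _)
  have h2 := hxp.trans_le (min_le_right _ _)
  have h3 := norm_le_norm_add_norm_sub x p
  exact h1.not_gt (hfar n g (hg _) x hx hgx' p (hVmono n.le_succ hpn) (by linarith))

end Slices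

/-! ### Short paths on the unit sphere -/

section Paths

variable {E : Type*} [NormedAddCommGroup E]

theorem norm_normalize_sub_le [NormedSpace ℝ E] {u v : E} {r : ℝ} (hr : 0 < r) (hu : r ≤ ‖u‖)
    (hv : v ≠ 0) : ‖‖u‖⁻¹ • u - ‖v‖⁻¹ • v‖ ≤ 2 / r * ‖u - v‖ := by
  have hu0 : 0 < ‖u‖ := hr.trans_le hu
  have hv0 : 0 < ‖v‖ := norm_pos_iff.2 hv
  have h1 : ‖u‖⁻¹ • u - ‖v‖⁻¹ • v = ‖u‖⁻¹ • ((u - v) + (‖v‖ - ‖u‖) • ‖v‖⁻¹ • v) := by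
    rw [sub_smul, smul_inv_smul₀ hv0.ne', smul_add, smul_sub, smul_sub, inv_smul_smul₀ hu0.ne']
    abel
  have h2 : ‖(‖v‖ - ‖u‖) • ‖v‖⁻¹ • v‖ ≤ ‖u - v‖ := by
    rw [norm_smul, norm_smul, norm_inv, norm_norm, inv_mul_cancel₀ hv0.ne', mul_one,
      norm_sub_rev u v]
    exact abs_norm_sub_norm_le v u
  rw [h1, norm_smul, norm_inv, norm_norm]
  calc ‖u‖⁻¹ * ‖(u - v) + (‖v‖ - ‖u‖) • ‖v‖⁻¹ • v‖ ≤ r⁻¹ * (‖u - v‖ + ‖u - v‖) := by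
        gcongr
        exact (norm_add_le _ _).trans (by gcongr)
    _ = 2 / r * ‖u - v‖ := by ring

/-- Two points `x`, `y` of the unit sphere with `1 ≤ ‖x + y‖` are joined on the sphere by a path
satisfying a Lipschitz condition with a universal constant, namely the normalized segment. -/
theorem exists_lipschitz_path [NormedSpace ℝ E] {x y : E} (hx : ‖x‖ = 1) (hy : ‖y‖ = 1)
    (hxy : 1 ≤ ‖x + y‖) : ∃ p : ℝ → E, p 0 = x ∧ p 1 = y ∧ (∀ t ∈ Icc (0 : ℝ) 1, ‖p t‖ = 1) ∧
      ∀ s ∈ Icc (0 : ℝ) 1, ∀ t ∈ Icc (0 : ℝ) 1, ‖p s - p t‖ ≤ 16 * |s - t| := by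
  let q : ℝ → E := fun t => (1 - t) • x + t • y
  have hsub : ∀ s t, q s - q t = (s - t) • (y - x) := fun s t => by simp only [q]; module
  have hyx : ‖y - x‖ ≤ 2 := (norm_sub_le y x).trans (by rw [hx, hy]; norm_num)
  -- The norm on the segment is bounded below near the midpoint because of `1 ≤ ‖x + y‖`, and away
  -- from the midpoint by the triangle inequality.
  have hlow : ∀ t ∈ Icc (0 : ℝ) 1, 1 / 4 ≤ ‖q t‖ := by
    rintro t ⟨h0, h1⟩
    have ha : ‖(1 - t) • x‖ = 1 - t := by
      rw [norm_smul, hx, mul_one, Real.norm_of_nonneg (by linarith)]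
    have hb : ‖t • y‖ = t := by rw [norm_smul, hy, mul_one, Real.norm_of_nonneg h0]
    have h3 : ‖(1 - t) • x‖ - ‖t • y‖ ≤ ‖q t‖ := norm_sub_le_norm_add _ _
    have h4 : ‖t • y‖ - ‖(1 - t) • x‖ ≤ ‖q t‖ := by
      have := norm_sub_le_norm_add (t • y) ((1 - t) • x)
      rwa [add_comm] at this
    have h5 : ‖q (1 / 2)‖ ≤ ‖q t‖ + |1 / 2 - t| * 2 := by
      have := norm_le_norm_add_norm_sub' (q (1 / 2)) (q t)
      rw [hsub, norm_smul, Real.norm_eq_abs] at this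
      refine this.trans ?_
      gcongr
    have h6 : 1 / 2 ≤ ‖q (1 / 2)‖ := by
      have : q (1 / 2) = (1 / 2 : ℝ) • (x + y) := by simp only [q]; module
      rw [this, norm_smul, Real.norm_of_nonneg (by norm_num)]
      linarith
    rw [ha, hb] at h3 h4
    rcases le_total (1 / 2 - t) 0 with h7 | h7
    · rw [abs_of_nonpos h7] at h5; linarith
    · rw [abs_of_nonneg h7] at h5; linarith
  refine ⟨fun t => ‖q t‖⁻¹ • q t, ?_, ?_, fun t ht => ?_, fun s hs t ht => ?_⟩
  · simp [q, hx]
  · simp [q, hy]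
  · have := hlow t ht
    rw [norm_smul, norm_inv, norm_norm, inv_mul_cancel₀ (by linarith)]
  · have h1 : q t ≠ 0 := norm_pos_iff.1 (by linarith [hlow t ht])
    refine (norm_normalize_sub_le (by norm_num) (hlow s hs) h1).trans ?_
    rw [hsub, norm_smul, Real.norm_eq_abs]
    nlinarith [abs_nonneg (s - t)]

/-- The number of steps of size less than `β` needed to go from `x` to `y` on the unit sphere can be
chosen independently of `x` and `y`. -/
theorem exists_chain (𝕜 : Type*) [RCLike 𝕜] [NormedSpace 𝕜 E] {β : ℝ} (hβ : 0 < β) :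
    ∃ n : ℕ, ∀ x y : E, ‖x‖ = 1 → ‖y‖ = 1 → 1 ≤ ‖x + y‖ → ∃ p : ℕ → E, p 0 = x ∧ p n = y ∧
      (∀ i ≤ n, ‖p i‖ = 1) ∧ ∀ i < n, ‖p i - p (i + 1)‖ < β := by
  let : NormedSpace ℝ E := .restrictScalars ℝ 𝕜 E
  obtain ⟨n, hn⟩ := exists_nat_gt (16 / β)
  have hn0 : (0 : ℝ) < n := lt_trans (by positivity) hn
  refine ⟨n, fun x y hx hy hxy => ?_⟩
  obtain ⟨p, hp0, hp1, hp, hlip⟩ := exists_lipschitz_path hx hy hxy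
  have hmem : ∀ i ≤ n, (i / n : ℝ) ∈ Icc (0 : ℝ) 1 := fun i hi =>
    ⟨by positivity, (div_le_one hn0).2 (by exact_mod_cast hi)⟩
  refine ⟨fun i => p (i / n), by simpa using hp0, by simpa [hn0.ne'] using hp1,
    fun i hi => hp _ (hmem i hi), fun i hi => ?_⟩
  refine (hlip _ (hmem i hi.le) _ (hmem (i + 1) hi)).trans_lt ?_
  have : (i / n - ((i + 1 : ℕ) : ℝ) / n : ℝ) = - (1 / n) := by push_cast; ring
  rw [this, abs_neg, abs_of_pos (by positivity)]
  rw [div_lt_iff₀ hβ] at hn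
  rw [mul_one_div, div_lt_iff₀ hn0]
  linarith

end Paths

/-! ### Uniform micro-semitransitivity -/

section Semitransitive

variable {𝕜 E : Type*} [RCLike 𝕜] [NormedAddCommGroup E] [NormedSpace 𝕜 E]

theorem UniformlyMicroSemitransitive.exists_pos (h : UniformlyMicroSemitransitive 𝕜 E) {ε : ℝ}
    (hε : 0 < ε) : ∃ β > 0, ∀ x y : E, ‖x‖ = 1 → ‖y‖ = 1 → ‖x - y‖ < β →
      ∃ T : E →L[𝕜] E, ‖T‖ ≤ 1 ∧ T x = y ∧ ‖T - ContinuousLinearMap.id 𝕜 E‖ < ε := by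
  obtain ⟨β, H⟩ := h
  have hm : min ε 1 ∈ Ioo (0 : ℝ) 2 :=
    ⟨lt_min hε one_pos, (min_le_right _ _).trans_lt one_lt_two⟩
  refine ⟨β ⟨_, hm⟩, (β ⟨_, hm⟩).2, fun x y hx hy hxy => ?_⟩
  obtain ⟨T, hT, hTx, hTI⟩ := H ⟨_, hm⟩ x y hx hy hxy
  exact ⟨T, hT.le, hTx, hTI.trans_le (min_le_left _ _)⟩

theorem UniformlyMicroSemitransitive.of_forall_exists_pos
    (h : ∀ ε > 0, ∃ β > 0, ∀ x y : E, ‖x‖ = 1 → ‖y‖ = 1 → ‖x - y‖ < β →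
      ∃ T : E →L[𝕜] E, ‖T‖ ≤ 1 ∧ T x = y ∧ ‖T - ContinuousLinearMap.id 𝕜 E‖ < ε) :
    UniformlyMicroSemitransitive 𝕜 E := by
  choose β hβ H using fun ε : Ioo (0 : ℝ) 2 => h ε ε.2.1
  refine ⟨fun ε => ⟨β ε, hβ ε⟩, fun ε x y hx hy hxy => ?_⟩
  obtain ⟨T, hT, hTx, hTI⟩ := H ε x y hx hy hxy
  refine ⟨T, le_antisymm hT ?_, hTx, hTI⟩
  have := T.le_opNorm x
  rwa [hTx, hx, hy, mul_one] at this

theorem norm_comp_le_one {F G : Type*} [NormedAddCommGroup F] [NormedSpace 𝕜 F]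
    [NormedAddCommGroup G] [NormedSpace 𝕜 G] {f : F →L[𝕜] G} {T : E →L[𝕜] F} (hf : ‖f‖ ≤ 1)
    (hT : ‖T‖ ≤ 1) : ‖f ∘L T‖ ≤ 1 :=
  (ContinuousLinearMap.opNorm_comp_le f T).trans (mul_le_one₀ hf (norm_nonneg _) hT)

/-- If `T` moves the normalization of `x - h` to that of `x + h` and `g` supports the ball at the
latter, then `g ∘ T` supports it at the former; as `T` is close to the identity, `g` and `g ∘ T`
are close, which bounds `‖x + h‖ + ‖x - h‖`. -/
theorem UniformlyMicroSemitransitive.uniformlySmooth (h : UniformlyMicroSemitransitive 𝕜 E) :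
    UniformlySmooth E := by
  intro ε hε
  obtain ⟨β, hβ, H⟩ := h.exists_pos hε
  refine ⟨min (1 / 2) (β / 16), by positivity, fun x k hx hk => ?_⟩
  let : NormedSpace ℝ E := .restrictScalars ℝ 𝕜 E
  have hk1 : ‖k‖ ≤ 1 / 2 := hk.trans (min_le_left _ _)
  have hk2 : ‖k‖ ≤ β / 16 := hk.trans (min_le_right _ _)
  have hp : 1 / 2 ≤ ‖x + k‖ := by have := norm_sub_le_norm_add x k; linarith
  have hm : 1 / 2 ≤ ‖x - k‖ := by have := norm_sub_norm_le x k; linarith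
  have hp0 : ‖x + k‖ ≠ 0 := by linarith
  have hm0 : ‖x - k‖ ≠ 0 := by linarith
  obtain ⟨T, hT, hTx, hTI⟩ := H (((‖x - k‖⁻¹ : ℝ) : 𝕜) • (x - k))
      (((‖x + k‖⁻¹ : ℝ) : 𝕜) • (x + k))
      (by rw [norm_smul, norm_ofReal, abs_inv, abs_norm, inv_mul_cancel₀ hm0])
      (by rw [norm_smul, norm_ofReal, abs_inv, abs_norm, inv_mul_cancel₀ hp0]) (by
    have h1 := norm_normalize_sub_le (by norm_num) hm (norm_ne_zero_iff.1 hp0)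
    have h2 : x - k - (x + k) = -(k + k) := by abel
    rw [h2, norm_neg] at h1
    have h3 := norm_add_le k k
    have h4 : ∀ (r : ℝ) (z : E), (r : 𝕜) • z = r • z := fun r z => by
      rw [← algebraMap_smul 𝕜 r z]
    rw [h4, h4]
    linarith)
  obtain ⟨g, hg, hgx⟩ := exists_dual_vector 𝕜 (x + k) hp0
  have hgT : g (T (x - k)) = (‖x - k‖ : 𝕜) := by
    have h1 : T (x - k) = ((‖x - k‖ : ℝ) : 𝕜) • T (((‖x - k‖⁻¹ : ℝ) : 𝕜) • (x - k)) := by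
      rw [map_smul, smul_smul, ← ofReal_mul, mul_inv_cancel₀ hm0, ofReal_one, one_smul]
    rw [h1, hTx, map_smul, map_smul, hgx, smul_eq_mul, smul_eq_mul, ← ofReal_mul,
      inv_mul_cancel₀ hp0, ofReal_one, mul_one]
  have e1 : ‖x + k‖ = re (g x) + re (g k) := by rw [← map_add, ← map_add, hgx, ofReal_re]
  have e2 : ‖x - k‖ = re (g (T x)) - re (g (T k)) := by
    rw [← map_sub, ← map_sub, ← map_sub, hgT, ofReal_re]
  have b1 : re (g x) ≤ 1 := hg ▸ g.re_apply_le_norm hx.le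
  have b2 : re (g (T x)) ≤ 1 :=
    (StrongDual.re_apply_le_norm (g ∘L T) hx.le).trans (norm_comp_le_one hg.le hT)
  have b3 : re (g k) - re (g (T k)) ≤ ε * ‖k‖ := by
    rw [← map_sub, ← map_sub]
    refine (g.re_apply_le _).trans ?_
    rw [hg, one_mul, norm_sub_rev]
    exact ((T - ContinuousLinearMap.id 𝕜 E).le_opNorm k).trans (by gcongr)
  linarith

/-- Any point of the unit sphere can be moved to any other one by an operator of norm at most `1`
that is bounded below by a constant not depending on the points: compose a bounded number of
operators close to the identity. -/
theorem UniformlyMicroSemitransitive.exists_boundedBelow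
    (h : UniformlyMicroSemitransitive 𝕜 E) : ∃ c > 0, ∀ x y : E, ‖x‖ = 1 → ‖y‖ = 1 →
      ∃ T : E →L[𝕜] E, ‖T‖ ≤ 1 ∧ T x = y ∧ ∀ z, c * ‖z‖ ≤ ‖T z‖ := by
  obtain ⟨β, hβ, H⟩ := h.exists_pos (by norm_num : (0 : ℝ) < 1 / 2)
  obtain ⟨n, hn⟩ := exists_chain (E := E) 𝕜 hβ
  have near : ∀ x y : E, ‖x‖ = 1 → ‖y‖ = 1 → 1 ≤ ‖x + y‖ →
      ∃ T : E →L[𝕜] E, ‖T‖ ≤ 1 ∧ T x = y ∧ ∀ z, (1 / 2) ^ n * ‖z‖ ≤ ‖T z‖ := by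
    intro x y hx hy hxy
    obtain ⟨p, hp0, hpn, hp, hd⟩ := hn x y hx hy hxy
    have key : ∀ i ≤ n, ∃ T : E →L[𝕜] E, ‖T‖ ≤ 1 ∧ T x = p i ∧
        ∀ z, (1 / 2) ^ i * ‖z‖ ≤ ‖T z‖ := by
      intro i
      induction i with
      | zero =>
        exact fun _ => ⟨ContinuousLinearMap.id 𝕜 E, ContinuousLinearMap.norm_id_le, by simp [hp0],
          by simp⟩
      | succ i ih =>
        intro hi
        obtain ⟨T, hT, hTx, hTz⟩ := ih (by omega)
        obtain ⟨S, hS, hSx, hSI⟩ := H (p i) (p (i + 1)) (hp i (by omega)) (hp _ hi) (hd i hi)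
        have hSz : ∀ z, 1 / 2 * ‖z‖ ≤ ‖S z‖ := by
          intro z
          have h1 := (S - ContinuousLinearMap.id 𝕜 E).le_of_opNorm_le hSI.le z
          have h2 := norm_sub_norm_le z (S z)
          rw [sub_apply, ContinuousLinearMap.id_apply, norm_sub_rev] at h1
          linarith
        refine ⟨S ∘L T, norm_comp_le_one hS hT, by simp [hTx, hSx], fun z => ?_⟩
        refine le_trans ?_ (hSz (T z))
        rw [pow_succ', mul_assoc]
        exact mul_le_mul_of_nonneg_left (hTz z) (by norm_num)
    obtain ⟨T, hT⟩ := key n le_rfl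
    exact ⟨T, hpn ▸ hT⟩
  refine ⟨(1 / 2) ^ n, by positivity, fun x y hx hy => ?_⟩
  rcases le_or_gt 1 ‖x + y‖ with hxy | hxy
  · exact near x y hx hy hxy
  · -- here `-x` and `y` are not nearly antipodal, and `x ↦ -x` is an isometry
    have h1 : 1 ≤ ‖-x + y‖ := by
      have h2 : y + y = (x + y) + (-x + y) := by abel
      have h3 : ‖y + y‖ = 2 := by
        rw [← two_smul 𝕜 y, norm_smul, hy, mul_one]; simp
      have h4 := norm_add_le (x + y) (-x + y)
      rw [← h2, h3] at h4
      linarith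
    obtain ⟨T, hT, hTx, hTz⟩ := near (-x) y (by simpa using hx) hy h1
    exact ⟨-T, by simpa using hT, by simpa using hTx, fun z => by simpa using hTz z⟩

/-- The unit ball has some slice of small diameter, by reflexivity, and operators bounded below move
every other slice into that one. -/
theorem UniformlyMicroSemitransitive.uniformConvexSpace [CompleteSpace E]
    (h : UniformlyMicroSemitransitive 𝕜 E) : UniformConvexSpace E := by
  have hS := h.uniformlySmooth
  have hR : IsReflexiveSpace 𝕜 E := hS.isReflexiveSpace
  rcases subsingleton_or_nontrivial E with hE | hE
  · exact ⟨fun ε hε => ⟨1, one_pos, fun x hx => by simp [Subsingleton.elim x 0] at hx⟩⟩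
  obtain ⟨c, hc, H⟩ := h.exists_boundedBelow
  refine ⟨fun ε hε => ?_⟩
  obtain ⟨f, hf, α, hα, hslice⟩ := hR.exists_small_slice (ε := c * (ε / 2)) (by positivity)
  obtain ⟨x₀, hx₀, hfx₀⟩ := hR.exists_apply_eq_one hf
  refine ⟨min α 1, by positivity, fun y hy z hz hyz => ?_⟩
  by_contra! hlt
  have hα1 := min_le_left α 1
  have hα2 := min_le_right α 1
  obtain ⟨g, hg, hgyz⟩ := exists_dual_vector 𝕜 (y + z) (by linarith)
  have hsum : re (g y) + re (g z) = ‖y + z‖ := by rw [← map_add, ← map_add, hgyz, ofReal_re]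
  have hgy : re (g y) ≤ 1 := hg ▸ g.re_apply_le_norm hy.le
  have hgz : re (g z) ≤ 1 := hg ▸ g.re_apply_le_norm hz.le
  obtain ⟨v, hv, hgv⟩ := hR.exists_apply_eq_one hg
  obtain ⟨T, hT, hTv, hTz⟩ := H v x₀ hv hx₀
  have hfT : f ∘L T = g :=
    hS.support_unique hv (norm_comp_le_one hf.le hT) hg.le (by simp [hTv, hfx₀]) hgv
  have hfTw : ∀ w, f (T w) = g w := fun w => by rw [← hfT]; rfl
  have hTy1 : ‖T y‖ ≤ 1 := (T.le_of_opNorm_le hT y).trans (by simp [hy])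
  have hTz1 : ‖T z‖ ≤ 1 := (T.le_of_opNorm_le hT z).trans (by simp [hz])
  have h1 := hslice (T y) (T z) hTy1 hTz1 (by rw [hfTw]; linarith) (by rw [hfTw]; linarith)
  rw [← map_sub] at h1
  have h2 := le_of_mul_le_mul_left ((hTz (y - z)).trans h1) hc
  linarith

/-! ### Duality -/

/-- Close functionals on `E` attain their norms at close points `x` and `y`, and the adjoint of a
contraction moving `y` to `x` moves the first functional to the second. -/
theorem UniformlyMicroSemitransitive.exists_duality [CompleteSpace E]
    (h : UniformlyMicroSemitransitive 𝕜 E) {ε : ℝ} (hε : 0 < ε) :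
    ∃ δ > 0, ∀ f g : StrongDual 𝕜 E, ‖f‖ = 1 → ‖g‖ = 1 → ‖f - g‖ < δ → ∃ x y : E,
      ‖x‖ = 1 ∧ ‖y‖ = 1 ∧ ‖x - y‖ < ε ∧
      ∀ T : E →L[𝕜] E, ‖T‖ ≤ 1 → T y = x → f ∘L T = g := by
  have hS := h.uniformlySmooth
  have hR : IsReflexiveSpace 𝕜 E := hS.isReflexiveSpace
  have := h.uniformConvexSpace
  obtain ⟨δ, hδ, H⟩ := UniformConvexSpace.exists_norm_sub_le (E := E) 𝕜 (half_pos hε)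
  refine ⟨δ, hδ, fun f g hf hg hfg => ?_⟩
  obtain ⟨x, hx, hfx⟩ := hR.exists_apply_eq_one hf
  obtain ⟨y, hy, hgy⟩ := hR.exists_apply_eq_one hg
  refine ⟨x, y, hx, hy, ?_, fun T hT hTy => ?_⟩
  · refine (H x y hx.le hy.le ?_).trans_lt (half_lt_self hε)
    have h1 := StrongDual.re_apply_le_norm' hf.le (x + y)
    have h2 := (g - f).re_apply_le_norm hy.le
    rw [norm_sub_rev] at h2
    simp only [sub_apply, map_add, map_sub, hfx, hgy, one_re] at h1 h2
    linarith
  · exact hS.support_unique hy (norm_comp_le_one hf.le hT) hg.le (by simp [hTy, hfx]) hgy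

theorem UniformlyMicroSemitransitive.dual [CompleteSpace E]
    (h : UniformlyMicroSemitransitive 𝕜 E) :
    UniformlyMicroSemitransitive 𝕜 (StrongDual 𝕜 E) := by
  refine .of_forall_exists_pos fun ε hε => ?_
  obtain ⟨β, hβ, H⟩ := h.exists_pos (half_pos hε)
  obtain ⟨δ, hδ, H'⟩ := h.exists_duality hβ
  refine ⟨δ, hδ, fun f g hf hg hfg => ?_⟩
  obtain ⟨x, y, hx, hy, hxy, hT⟩ := H' f g hf hg hfg
  obtain ⟨T, hT1, hTy, hTI⟩ := H y x hy hx (by rwa [norm_sub_rev])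
  refine ⟨(ContinuousLinearMap.compL 𝕜 E E 𝕜).flip T, ?_, hT T hT1 hTy, ?_⟩
  · refine ContinuousLinearMap.opNorm_le_bound _ zero_le_one fun k => ?_
    refine (ContinuousLinearMap.opNorm_comp_le k T).trans ?_
    rw [mul_comm]
    gcongr
  · refine lt_of_le_of_lt ?_ (half_lt_self hε)
    refine ContinuousLinearMap.opNorm_le_bound _ (by positivity) fun k => ?_
    have h1 : ((ContinuousLinearMap.compL 𝕜 E E 𝕜).flip T
        - ContinuousLinearMap.id 𝕜 (StrongDual 𝕜 E)) k
          = k ∘L (T - ContinuousLinearMap.id 𝕜 E) := by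
      ext z; simp
    rw [h1, mul_comm]
    refine (ContinuousLinearMap.opNorm_comp_le k _).trans ?_
    gcongr

/-- Uniform micro-semitransitivity is an isometric invariant. -/
theorem UniformlyMicroSemitransitive.of_equiv {F : Type*} [NormedAddCommGroup F]
    [NormedSpace 𝕜 F] (e : E ≃ₗᵢ[𝕜] F) (h : UniformlyMicroSemitransitive 𝕜 F) :
    UniformlyMicroSemitransitive 𝕜 E := by
  refine .of_forall_exists_pos fun ε hε => ?_
  obtain ⟨β, hβ, H⟩ := h.exists_pos (half_pos hε)
  refine ⟨β, hβ, fun x y hx hy hxy => ?_⟩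
  obtain ⟨T, hT, hTx, hTI⟩ := H (e x) (e y) (by rwa [e.norm_map]) (by rwa [e.norm_map])
    (by rwa [← map_sub, e.norm_map])
  refine ⟨e.symm.toContinuousLinearEquiv.toContinuousLinearMap ∘L T ∘L
    e.toContinuousLinearEquiv.toContinuousLinearMap, ?_, by simp [hTx], ?_⟩
  · refine ContinuousLinearMap.opNorm_le_bound _ zero_le_one fun z => ?_
    simpa using T.le_of_opNorm_le hT (e z)
  · refine lt_of_le_of_lt ?_ (half_lt_self hε)
    refine ContinuousLinearMap.opNorm_le_bound _ (by positivity) fun z => ?_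
    have h1 := (T - ContinuousLinearMap.id 𝕜 F).le_of_opNorm_le hTI.le (e z)
    rw [e.norm_map] at h1
    refine le_of_eq_of_le ?_ h1
    rw [← e.norm_map]
    simp

theorem uniformlyMicroSemitransitive_dual_iff [CompleteSpace E] :
    UniformlyMicroSemitransitive 𝕜 (StrongDual 𝕜 E) ↔ UniformlyMicroSemitransitive 𝕜 E :=
  ⟨fun h => h.dual.of_equiv
    (IsReflexiveSpace.of_dual h.uniformlySmooth.isReflexiveSpace).equivDoubleDual, fun h => h.dual⟩

end Semitransitive

/-! ### Micro-transitivity -/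

/-- The uniform form of micro-transitivity, in which the size of the neighbourhood of a point of the
unit sphere that is reached by isometries `ε`-close to the identity depends on `ε` only. -/
def UniformlyMicroTransitive (𝕜 X : Type*) [RCLike 𝕜] [NormedAddCommGroup X]
    [NormedSpace 𝕜 X] : Prop :=
  ∀ ε > 0, ∃ β > 0, ∀ x y : X, ‖x‖ = 1 → ‖y‖ = 1 → ‖x - y‖ < β →
    ∃ g : X ≃ₗᵢ[𝕜] X, g x = y ∧ ‖isometryToOperator g - ContinuousLinearMap.id 𝕜 X‖ < ε

section MicroTransitive

variable {𝕜 E : Type*} [RCLike 𝕜] [NormedAddCommGroup E] [NormedSpace 𝕜 E]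

theorem norm_isometryToOperator_le (g : E ≃ₗᵢ[𝕜] E) : ‖isometryToOperator g‖ ≤ 1 :=
  g.toLinearIsometry.norm_toContinuousLinearMap_le

theorem isometryToOperator_one :
    isometryToOperator (1 : E ≃ₗᵢ[𝕜] E) = ContinuousLinearMap.id 𝕜 E := rfl

theorem UniformlyMicroTransitive.uniformlyMicroSemitransitive
    (h : UniformlyMicroTransitive 𝕜 E) : UniformlyMicroSemitransitive 𝕜 E := by
  refine .of_forall_exists_pos fun ε hε => ?_
  obtain ⟨β, hβ, H⟩ := h ε hε
  refine ⟨β, hβ, fun x y hx hy hxy => ?_⟩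
  obtain ⟨g, hgx, hg⟩ := H x y hx hy hxy
  exact ⟨isometryToOperator g, norm_isometryToOperator_le g, hgx, hg⟩

theorem MicroTransitive.exists_pos (h : MicroTransitive 𝕜 E) {x : E} (hx : ‖x‖ = 1) {ε : ℝ}
    (hε : 0 < ε) : ∃ β > 0, ∀ y : E, ‖y‖ = 1 → ‖x - y‖ < β →
      ∃ g : E ≃ₗᵢ[𝕜] E, g x = y ∧
        ‖isometryToOperator g - ContinuousLinearMap.id 𝕜 E‖ < ε := by
  have hU : isometryToOperator ⁻¹' ball (ContinuousLinearMap.id 𝕜 E) ε ∈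
      nhds (1 : E ≃ₗᵢ[𝕜] E) :=
    continuous_isometryToOperator.continuousAt.preimage_mem_nhds (ball_mem_nhds _ hε)
  obtain ⟨β, hβ, H⟩ := Metric.mem_nhds_iff.1 (h ⟨x, mem_sphere_zero_iff_norm.2 hx⟩ _ hU)
  refine ⟨β, hβ, fun y hy hxy => ?_⟩
  have hy' : (⟨y, mem_sphere_zero_iff_norm.2 hy⟩ : sphere (0 : E) 1) ∈
      ball (⟨x, mem_sphere_zero_iff_norm.2 hx⟩ : sphere (0 : E) 1) β := by
    rw [mem_ball, Subtype.dist_eq, dist_comm, dist_eq_norm]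
    exact hxy
  obtain ⟨g, hg, hgx⟩ := H hy'
  rw [mem_preimage, mem_ball, dist_eq_norm] at hg
  exact ⟨g, congrArg Subtype.val hgx, hg⟩

/-- A micro-transitive norm is transitive: the orbits on the unit sphere are open, hence constant
along paths. -/
theorem MicroTransitive.exists_apply_eq (h : MicroTransitive 𝕜 E) {x y : E} (hx : ‖x‖ = 1)
    (hy : ‖y‖ = 1) : ∃ g : E ≃ₗᵢ[𝕜] E, g x = y := by
  let : NormedSpace ℝ E := .restrictScalars ℝ 𝕜 E
  have near : ∀ x y : E, ‖x‖ = 1 → ‖y‖ = 1 → 1 ≤ ‖x + y‖ → ∃ g : E ≃ₗᵢ[𝕜] E, g x = y := by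
    intro x y hx hy hxy
    obtain ⟨p, hp0, hp1, hp, hlip⟩ := exists_lipschitz_path hx hy hxy
    rw [← hp0, ← hp1]
    refine (isPreconnected_Icc (a := (0 : ℝ)) (b := 1)).induction₂
      (fun s t => ∃ g : E ≃ₗᵢ[𝕜] E, g (p s) = p t) ?_ ?_ ?_ (by simp) (by simp)
    · intro s hs
      obtain ⟨β, hβ, H⟩ := h.exists_pos (hp s hs) one_pos
      filter_upwards [self_mem_nhdsWithin,
        mem_nhdsWithin_of_mem_nhds (ball_mem_nhds s (by positivity : 0 < β / 16))] with t ht hst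
      rw [mem_ball, dist_comm, Real.dist_eq] at hst
      obtain ⟨g, hg, -⟩ := H (p t) (hp t ht) ((hlip s hs t ht).trans_lt (by linarith))
      exact ⟨g, hg⟩
    · rintro r s t - - - ⟨g₁, h₁⟩ ⟨g₂, h₂⟩
      exact ⟨g₁.trans g₂, by simp [h₁, h₂]⟩
    · rintro s t - - ⟨g, hg⟩
      exact ⟨g.symm, by simp [← hg]⟩
  rcases le_or_gt 1 ‖x + y‖ with hxy | hxy
  · exact near x y hx hy hxy
  · have h1 : 1 ≤ ‖-x + y‖ := by
      have h2 := norm_add_le (x + y) (-x + y)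
      have h3 : (x + y) + (-x + y) = (2 : ℝ) • y := by module
      rw [h3, norm_smul, hy, Real.norm_of_nonneg zero_le_two] at h2
      linarith
    obtain ⟨g, hg⟩ := near (-x) y (by simpa using hx) hy h1
    exact ⟨(LinearIsometryEquiv.neg 𝕜).trans g, by simpa using hg⟩

/-- By transitivity, isometries close to the identity at one point can be conjugated to any other
point. -/
theorem microTransitive_iff : MicroTransitive 𝕜 E ↔ UniformlyMicroTransitive 𝕜 E := by
  refine ⟨fun h ε hε => ?_, fun h => ?_⟩
  · by_cases hne : ∃ x₀ : E, ‖x₀‖ = 1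
    · obtain ⟨x₀, hx₀⟩ := hne
      obtain ⟨β, hβ, H⟩ := h.exists_pos hx₀ (half_pos hε)
      refine ⟨β, hβ, fun x y hx hy hxy => ?_⟩
      obtain ⟨s, rfl⟩ := h.exists_apply_eq hx₀ hx
      obtain ⟨g, hg, hgε⟩ := H (s.symm y) (by rwa [s.symm.norm_map])
        (by rwa [← s.norm_map, map_sub, s.apply_symm_apply])
      refine ⟨(s.symm.trans g).trans s, by simp [hg], lt_of_le_of_lt ?_ (half_lt_self hε)⟩
      refine ContinuousLinearMap.opNorm_le_bound _ (by positivity) fun z => ?_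
      have h1 := (isometryToOperator g - ContinuousLinearMap.id 𝕜 E).le_of_opNorm_le hgε.le
        (s.symm z)
      rw [s.symm.norm_map] at h1
      refine le_of_eq_of_le ?_ h1
      rw [← s.symm.norm_map]
      simp [isometryToOperator_apply]
    · exact ⟨1, one_pos, fun x y hx => absurd ⟨x, hx⟩ hne⟩
  · rintro ⟨x, hx⟩ U hU
    obtain ⟨V, hV, hVU⟩ := mem_nhds_induced _ _ _ |>.1 hU
    obtain ⟨ε, hε, hεV⟩ := Metric.mem_nhds_iff.1 hV
    obtain ⟨β, hβ, H⟩ := h ε hε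
    refine Metric.mem_nhds_iff.2 ⟨β, hβ, ?_⟩
    rintro ⟨y, hy⟩ hxy
    rw [mem_ball, Subtype.dist_eq, dist_comm, dist_eq_norm] at hxy
    obtain ⟨g, hgx, hg⟩ := H x y (mem_sphere_zero_iff_norm.1 hx) (mem_sphere_zero_iff_norm.1 hy) hxy
    refine ⟨g, hVU (hεV ?_), Subtype.ext hgx⟩
    rw [mem_ball, dist_eq_norm, isometryToOperator_one]
    exact hg

/-- The adjoint of a surjective linear isometry. -/
noncomputable def LinearIsometryEquiv.adjointDual (g : E ≃ₗᵢ[𝕜] E) :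
    StrongDual 𝕜 E ≃ₗᵢ[𝕜] StrongDual 𝕜 E where
  toLinearEquiv :=
    (g.symm.toContinuousLinearEquiv.arrowCongr (ContinuousLinearEquiv.refl 𝕜 𝕜)).toLinearEquiv
  norm_map' f := ContinuousLinearMap.opNorm_comp_linearIsometryEquiv f g

theorem LinearIsometryEquiv.adjointDual_apply (g : E ≃ₗᵢ[𝕜] E) (f : StrongDual 𝕜 E) :
    g.adjointDual f = f ∘L isometryToOperator g := rfl

theorem UniformlyMicroTransitive.dual [CompleteSpace E] (h : UniformlyMicroTransitive 𝕜 E) :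
    UniformlyMicroTransitive 𝕜 (StrongDual 𝕜 E) := by
  intro ε hε
  obtain ⟨β, hβ, H⟩ := h (ε / 2) (half_pos hε)
  obtain ⟨δ, hδ, H'⟩ := h.uniformlyMicroSemitransitive.exists_duality hβ
  refine ⟨δ, hδ, fun f g hf hg hfg => ?_⟩
  obtain ⟨x, y, hx, hy, hxy, hT⟩ := H' f g hf hg hfg
  obtain ⟨s, hsy, hs⟩ := H y x hy hx (by rwa [norm_sub_rev])
  refine ⟨s.adjointDual, hT _ (norm_isometryToOperator_le s) hsy,
    lt_of_le_of_lt ?_ (half_lt_self hε)⟩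
  refine ContinuousLinearMap.opNorm_le_bound _ (by positivity) fun k => ?_
  have h1 : (isometryToOperator s.adjointDual - ContinuousLinearMap.id 𝕜 (StrongDual 𝕜 E)) k
      = k ∘L (isometryToOperator s - ContinuousLinearMap.id 𝕜 E) := by
    rw [sub_apply, isometryToOperator_apply, s.adjointDual_apply]
    ext z; simp
  rw [h1, mul_comm]
  refine (ContinuousLinearMap.opNorm_comp_le k _).trans ?_
  gcongr

/-- Uniform micro-transitivity is an isometric invariant. -/
theorem UniformlyMicroTransitive.of_equiv {F : Type*} [NormedAddCommGroup F] [NormedSpace 𝕜 F]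
    (e : E ≃ₗᵢ[𝕜] F) (h : UniformlyMicroTransitive 𝕜 F) : UniformlyMicroTransitive 𝕜 E := by
  intro ε hε
  obtain ⟨β, hβ, H⟩ := h (ε / 2) (half_pos hε)
  refine ⟨β, hβ, fun x y hx hy hxy => ?_⟩
  obtain ⟨g, hgx, hg⟩ := H (e x) (e y) (by rwa [e.norm_map]) (by rwa [e.norm_map])
    (by rwa [← map_sub, e.norm_map])
  refine ⟨(e.trans g).trans e.symm, by simp [hgx], lt_of_le_of_lt ?_ (half_lt_self hε)⟩
  refine ContinuousLinearMap.opNorm_le_bound _ (by positivity) fun z => ?_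
  have h1 := (isometryToOperator g - ContinuousLinearMap.id 𝕜 F).le_of_opNorm_le hg.le (e z)
  rw [e.norm_map] at h1
  refine le_of_eq_of_le ?_ h1
  rw [← e.norm_map]
  simp [isometryToOperator_apply]

theorem uniformlyMicroTransitive_dual_iff [CompleteSpace E] :
    UniformlyMicroTransitive 𝕜 (StrongDual 𝕜 E) ↔ UniformlyMicroTransitive 𝕜 E :=
  ⟨fun h => h.dual.of_equiv (IsReflexiveSpace.of_dual
    h.uniformlyMicroSemitransitive.uniformlySmooth.isReflexiveSpace).equivDoubleDual,
    fun h => h.dual⟩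

end MicroTransitive

theorem mainTheorem2 {𝕜 X : Type*} [RCLike 𝕜] [NormedAddCommGroup X] [NormedSpace 𝕜 X]
    [CompleteSpace X] :
    (UniformlyMicroSemitransitive 𝕜 X ↔ UniformlyMicroSemitransitive 𝕜 (StrongDual 𝕜 X)) ∧
      (MicroTransitive 𝕜 X ↔ MicroTransitive 𝕜 (StrongDual 𝕜 X)) := by
  refine ⟨uniformlyMicroSemitransitive_dual_iff.symm, ?_⟩
  rw [microTransitive_iff, microTransitive_iff, uniformlyMicroTransitive_dual_iff]
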